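/- Let $d\ge 3$ and let $\langle Q;+,\cdot,<\rangle$ be a Euclidean ordered field (a linearly ordered field in which positive elements have square roots). For $\vec p=\langle p_1,\dots,p_d\rangle\in Q^d$ put $p_\tau:=p_1$ and $\vec p_\sigma:=\langle p_2,\dots,p_d\rangle$; $|\cdot|$ is the Euclidean length $|\vec x|=\sqrt{\sum_i x_i^2}$, and $B_\delta(\vec q)=\{\vec p:|\vec p-\vec q|<\delta\}$. A model of the frame language consists of such a field, a set $B$ of bodies, sets $Ob,Ph\subseteq B$ (observers, photons), a set $IOb\subseteq Ob$ (inertial observers) and a worldview relation $W\subseteq Ob\times B\times Q^d$. Put $ev_m(\vec p):=\{b: W(m,b,\vec p)\}$, $Ev_m:=\{ev_m(\vec p):\vec p\in Q^d,\ ev_m(\vec p)\ne\emptyset\}$, $Ev:=\bigcup_{m\in Ob}Ev_m$, $Cd_m:=\{\vec p: ev_m(\vec p)\neq\emptyset\}$ and $w^k_m:=\{\langle\vec p,\vec q\rangle: ev_k(\vec p)=ev_m(\vec q)\ne\emptyset\}$. Let $loc_m(e)$ be the unique $\vec p$ with $ev_m(\vec p)=e$ (undefined if there is no unique one), and $dist_m(e_1,e_2):=|loc_m(e_1)_\sigma-loc_m(e_2)_\sigma|$.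 Write $e_1\sim_m e_2$ if there are $\vec p,\vec q$ with $ev_m(\vec p)=e_1$, $ev_m(\vec q)=e_2$, $p_\tau=q_\tau$. A set $H\subseteq Q$ is connected if $z\in H$ whenever $x,y\in H$ and $x<z<y$. Equations between partially defined terms assert that both sides are defined. Write $m\succ_{\vec q}k$ ($m$ is a co-moving observer of $k$ at $\vec q$) if $\vec q\in Dom\,w^k_m$ and for every $\varepsilon>0$ in $Q$ there is $\delta>0$ in $Q$ such that for all $\vec p\in B_\delta(\vec q)\cap Dom\,w^k_m$ the value $w^k_m(\vec p)$ is unique and $|w^k_m(\vec p)-\vec p|\le\varepsilon|\vec p-\vec q|$. Assume $\mathsf{AccRel}_0$, i.e. the following axioms: 1. (AxSelf$_0$) for all $m\in Ob$ and $\vec p\in Q^d$: $m\in ev_m(\vec p)$ iff $\vec p\in Cd_m$ and $\vec p_\sigma=\vec o$ (the zero vector); 2. (AxSelf$^+_0$) for all $k\in Ob$, the set $\{r_\tau: k\in ev_k(\vec r)\}$ is connected and has at least two elements; 3. (AxPh) for all $m\in IOb$ and $\vec p,\vec q\in Q^d$: $|\vec p_\sigma-\vec q_\sigma|=|p_\tau-q_\tau|$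 iff $Ph\cap ev_m(\vec p)\cap ev_m(\vec q)\neq\emptyset$; 4. (AxEv) $Ev_m=Ev_k$ for all $m,k\in IOb$; 5. (AxEvTr) for all $m\in Ob$ and $e\in Ev$, if $m\in e$ then $e\in Ev_m$; 6. (AxSymDist) for all $m,k\in IOb$ and $e_1,e_2\in Ev_m\cap Ev_k$, if $e_1\sim_m e_2$ and $e_1\sim_k e_2$ then $dist_m(e_1,e_2)=dist_k(e_1,e_2)$; 7. (AxCmv) for all $k\in Ob$ and $\vec q\in Q^d$ with $k\in ev_k(\vec q)$ there is $m\in IOb$ with $m\succ_{\vec q}k$. Let $k\in Ob$ and $m\in IOb$. Then the life-curve $$lc^k_m:=\{\langle t,\vec p\rangle\in Q\times Q^d:\ \exists \vec q\in Q^d\ \ k\in ev_k(\vec q)=ev_m(\vec p),\ q_\tau=t\}$$ is a well-parametrized timelike curve. That is: $lc^k_m$ is a (partial) function $\gamma$ from $Q$ to $Q^d$; its domain is connected and has at least two elements; and at every $t\in Dom\,\gamma$ it is differentiable and its derivative $\gamma'(t)$ is timelike, $|\gamma'(t)_\sigma|<|\gamma'(t)_\tau|$, and satisfies $\mu(\gamma'(t))=1$.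 Here $\vec v\in Q^d$ is a derivative of $\gamma$ at $t\in Dom\,\gamma$ if for every $\varepsilon>0$ in $Q$ there is $\delta>0$ in $Q$ with $|\gamma(s)-\gamma(t)-(s-t)\vec v|\le\varepsilon|s-t|$ for all $s\in Dom\,\gamma$ with $|s-t|<\delta$, and $\mu(\vec v)$ is the signed Minkowski length, equal to $\sqrt{v_\tau^2-|\vec v_\sigma|^2}$ if $v_\tau^2\ge|\vec v_\sigma|^2$ and to $-\sqrt{|\vec v_\sigma|^2-v_\tau^2}$ otherwise. -/

import Mathlib

/-! ### Euclidean ordered fields, coordinate points and curves -/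

/-- Positive elements have square roots. -/
def IsEuclideanField (Q : Type*) [Field Q] [LinearOrder Q] [IsStrictOrderedRing Q] : Prop :=
  ∀ x : Q, 0 < x → ∃ y : Q, y * y = x

open Classical in
/-- The nonnegative square root of `x` if there is one (it is then unique), and `0` otherwise. -/
noncomputable def qsqrt {Q : Type*} [Field Q] [LinearOrder Q] [IsStrictOrderedRing Q] (x : Q) : Q :=
  if h : ∃ y : Q, 0 ≤ y ∧ y * y = x then Classical.choose h else 0

/-- Euclidean length of a tuple of quantities. -/
noncomputable def euclLength {Q : Type*} [Field Q] [LinearOrder Q] [IsStrictOrderedRing Q]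
    {ι : Type*} [Fintype ι] (v : ι → Q) : Q :=
  qsqrt (∑ i, v i ^ 2)

/-- Time component; coordinates are numbered from `0`, coordinate `0` being time. -/
def timeComp {Q : Type*} {d : ℕ} [NeZero d] (p : Fin d → Q) : Q := p 0

/-- Space component: the tuple of all coordinates except the time coordinate. -/
def spaceComp {Q : Type*} {d : ℕ} [NeZero d] (p : Fin d → Q) : {i : Fin d // i ≠ 0} → Q :=
  fun i => p i

/-- A spacetime vector is timelike iff its space component is shorter than its time component. -/
def IsTimelike {Q : Type*} [Field Q] [LinearOrder Q] [IsStrictOrderedRing Q]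
    {d : ℕ} [NeZero d] (r : Fin d → Q) : Prop :=
  euclLength (spaceComp r) < |timeComp r|

/-- The signed Minkowski length. -/
noncomputable def minkLength {Q : Type*} [Field Q] [LinearOrder Q] [IsStrictOrderedRing Q]
    {d : ℕ} [NeZero d] (p : Fin d → Q) : Q :=
  if euclLength (spaceComp p) ^ 2 ≤ timeComp p ^ 2 then
    qsqrt (timeComp p ^ 2 - euclLength (spaceComp p) ^ 2)
  else
    -qsqrt (euclLength (spaceComp p) ^ 2 - timeComp p ^ 2)

/-- A binary relation is a (partial) function. -/
def IsPartialFunction {α β : Type*} (R : Set (α × β)) : Prop :=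
  ∀ a b b', (a, b) ∈ R → (a, b') ∈ R → b = b'

/-- The domain of a binary relation. -/
def relDom {α β : Type*} (R : Set (α × β)) : Set α := {a | ∃ b, (a, b) ∈ R}

/-- A curve: a partial function from quantities to coordinate points whose domain is connected
(contains every point between two of its points) and has at least two distinct elements. -/
def IsCurve {Q : Type*} [LinearOrder Q] {d : ℕ} (γ : Set (Q × (Fin d → Q))) : Prop :=
  IsPartialFunction γ ∧ (relDom γ).OrdConnected ∧ (relDom γ).Nontrivial

/-- `v` is a derivative vector of the partial function `γ` at the point `t` of its domain, i.e.
the linear map `s ↦ s • v` is a derivative of `γ` at `t`. -/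
def IsDerivVector {Q : Type*} [Field Q] [LinearOrder Q] [IsStrictOrderedRing Q] {d : ℕ}
    (γ : Set (Q × (Fin d → Q))) (t : Q) (v : Fin d → Q) : Prop :=
  ∃ p₀, (t, p₀) ∈ γ ∧ ∀ ε : Q, 0 < ε → ∃ δ : Q, 0 < δ ∧ ∀ s p, (s, p) ∈ γ → |s - t| < δ →
    euclLength (p - p₀ - (s - t) • v) ≤ ε * |s - t|

/-- A timelike curve: a curve that is differentiable at every point of its domain, with timelike
derivative vectors. -/
def IsTimelikeCurve {Q : Type*} [Field Q] [LinearOrder Q] [IsStrictOrderedRing Q]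
    {d : ℕ} [NeZero d] (γ : Set (Q × (Fin d → Q))) : Prop :=
  IsCurve γ ∧ ∀ t ∈ relDom γ,
    (∃ v, IsDerivVector γ t v) ∧ ∀ v, IsDerivVector γ t v → IsTimelike v

/-- A well-parametrized timelike curve: its derivative has Minkowski length `1` everywhere. -/
def IsWellParametrizedTimelikeCurve {Q : Type*} [Field Q] [LinearOrder Q] [IsStrictOrderedRing Q]
    {d : ℕ} [NeZero d] (γ : Set (Q × (Fin d → Q))) : Prop :=
  IsTimelikeCurve γ ∧ ∀ t ∈ relDom γ, ∀ v, IsDerivVector γ t v → minkLength v = 1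

/-! ### The frame language and its models -/

/-- An interpretation of the non-logical symbols `Ob`, `IOb`, `Ph`, `W` of the (two-sorted) frame
language, with sort of bodies `Body` and sort of quantities `Q`. The axioms are stated below. -/
structure KinFrame (Q : Type*) (d : ℕ) (Body : Type*) where
  /-- observers -/
  Ob : Set Body
  /-- inertial observers -/
  IOb : Set Body
  /-- photons -/
  Ph : Set Body
  /-- `W m b p`: observer `m` coordinatizes body `b` at the coordinate point `p` -/
  W : Body → Body → (Fin d → Q) → Prop

namespace KinFrame

variable {Q : Type*} [Field Q] [LinearOrder Q] [IsStrictOrderedRing Q] {d : ℕ} [NeZero d]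
  {Body : Type*} (M : KinFrame Q d Body)

/-- The event observed by `m` at `p`. -/
def ev (m : Body) (p : Fin d → Q) : Set Body := {b | M.W m b p}

/-- The nonempty events coordinatized by `m`. -/
def Ev (m : Body) : Set (Set Body) := {e | ∃ p, M.ev m p = e ∧ e.Nonempty}

/-- All observed events. -/
def allEv : Set (Set Body) := {e | ∃ m ∈ M.Ob, e ∈ M.Ev m}

/-- The coordinate domain of `m`. -/
def Cd (m : Body) : Set (Fin d → Q) := {p | (M.ev m p).Nonempty}

/-- The worldview transformation `w^k_m` between the coordinate systems of `k` and `m`. -/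
def worldview (k m : Body) : Set ((Fin d → Q) × (Fin d → Q)) :=
  {x | M.ev k x.1 = M.ev m x.2 ∧ (M.ev k x.1).Nonempty}

/-- `p` is the location of the event `e` according to `m`: the only coordinate point at which `m`
observes `e`. -/
def IsLoc (m : Body) (e : Set Body) (p : Fin d → Q) : Prop := ∀ q, M.ev m q = e ↔ q = p

/-- Events `e₁` and `e₂` are localized by `m` and `r` is their spatial distance for `m`. -/
def IsDist (m : Body) (e₁ e₂ : Set Body) (r : Q) : Prop :=
  ∃ p q, M.IsLoc m e₁ p ∧ M.IsLoc m e₂ q ∧ r = euclLength (spaceComp p - spaceComp q)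

/-- Events `e₁` and `e₂` are simultaneous for `m`. -/
def Simultaneous (m : Body) (e₁ e₂ : Set Body) : Prop :=
  ∃ p q, M.ev m p = e₁ ∧ M.ev m q = e₂ ∧ timeComp p = timeComp q

/-- `m` is a co-moving observer of `k` at `q`. Writing the value `w^k_m(p)` includes the claim that
it exists and is unique. -/
def CoMoving (m k : Body) (q : Fin d → Q) : Prop :=
  q ∈ relDom (M.worldview k m) ∧
    ∀ ε : Q, 0 < ε → ∃ δ : Q, 0 < δ ∧ ∀ p ∈ relDom (M.worldview k m), euclLength (q - p) < δ →
      ∃ p', (∀ p'', (p, p'') ∈ M.worldview k m ↔ p'' = p') ∧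
        euclLength (p' - p) ≤ ε * euclLength (p - q)

/-- The life-curve of `k` according to `m`: the world-line of `k` according to `m`, parametrized by
the time measured by `k`. -/
def lifeCurve (k m : Body) : Set (Q × (Fin d → Q)) :=
  {x | ∃ q, k ∈ M.ev k q ∧ M.ev k q = M.ev m x.2 ∧ timeComp q = x.1}

/-- Inertial observers are observers, and only observers coordinatize bodies. (The remaining sort
conditions hold by typing.) -/
def AxFrame : Prop := M.IOb ⊆ M.Ob ∧ ∀ m b p, M.W m b p → m ∈ M.Ob

/-- An observer coordinatizes itself at a coordinate point iff the point is in its coordinate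
domain and has space component the origin. -/
def AxSelf₀ : Prop :=
  ∀ m ∈ M.Ob, ∀ p, m ∈ M.ev m p ↔ p ∈ M.Cd m ∧ spaceComp p = 0

/-- The set of time-instances in which an observer encounters an event is connected and has at
least two distinct elements. -/
def AxSelfPlus₀ : Prop :=
  ∀ k ∈ M.Ob, (∃ p q, timeComp p ≠ timeComp q ∧ k ∈ M.ev k p ∩ M.ev k q) ∧
    {t : Q | ∃ r, k ∈ M.ev k r ∧ timeComp r = t}.OrdConnected

/-- For every inertial observer, there is a photon through two points iff their slope is `1`. -/
def AxPh : Prop :=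
  ∀ m ∈ M.IOb, ∀ p q : Fin d → Q,
    euclLength (spaceComp p - spaceComp q) = |timeComp p - timeComp q| ↔
      (M.Ph ∩ M.ev m p ∩ M.ev m q).Nonempty

/-- Inertial observers coordinatize the same events. -/
def AxEv : Prop := ∀ m ∈ M.IOb, ∀ k ∈ M.IOb, M.Ev m = M.Ev k

/-- Every observer encounters the events in which it has been observed. -/
def AxEvTr : Prop := ∀ m ∈ M.Ob, ∀ e ∈ M.allEv, m ∈ e → e ∈ M.Ev m

/-- Inertial observers agree as to the spatial distance between events that are simultaneous for
both of them. The equation of distances includes the claim that both are defined. -/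
def AxSymDist : Prop :=
  ∀ m ∈ M.IOb, ∀ k ∈ M.IOb, ∀ e₁ ∈ M.Ev m ∩ M.Ev k, ∀ e₂ ∈ M.Ev m ∩ M.Ev k,
    M.Simultaneous m e₁ e₂ → M.Simultaneous k e₁ e₂ →
      ∃ r, M.IsDist m e₁ e₂ r ∧ M.IsDist k e₁ e₂ r

/-- For every observer and event encountered by it, there is a co-moving inertial observer. -/
def AxCmv : Prop :=
  ∀ k ∈ M.Ob, ∀ q, k ∈ M.ev k q → ∃ m ∈ M.IOb, M.CoMoving m k q

/-- The axiom system for accelerated observers, including the two axioms of the logic frame. -/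
structure AccRel₀ : Prop where
  axFrame : M.AxFrame
  axEOF : IsEuclideanField Q
  axSelf : M.AxSelf₀
  axSelfPlus : M.AxSelfPlus₀
  axPh : M.AxPh
  axEv : M.AxEv
  axEvTr : M.AxEvTr
  axSymDist : M.AxSymDist
  axCmv : M.AxCmv

end KinFrame

/-! At an event on its own world-line, `k` has a co-moving inertial observer `m₀`, whose worldview
agrees with that of `k` to first order. By `AxSelf₀` the world-line of `k` lies on its own time
axis, so its life-curve according to `m₀` has the unit time vector `e₀` as derivative there. Passing
from `m₀` to `m` applies a Poincaré map with linear part `L`, hence the derivative becomes `L e₀`,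
whose Minkowski square is that of `e₀`, namely `1`. Such a vector is timelike of Minkowski length
`1`. This is `exists_derivVector_lifeCurve`; `derivVector_unique` extends it to every derivative
vector.

The main work is `exists_poincare`, an Alexandrov–Zeeman type theorem over a Euclidean field. By
`AxPh` the transformation between inertial observers preserves null separation in both directions.
Null parallelograms go to null parallelograms, so it is additive up to a translation
(`exists_addMonoidHom`). The additive part scales all axes by one multiplicative function `φ`
(`exists_scaling`, `scaling_mul`), hence is semilinear and conformal for the Minkowski form.
`AxSymDist`, applied to spatial vectors with spatial image, forces `φ = id` and conformal factor `1`
(`exists_lorentz`). -/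

/-! ### The Minkowski form -/

section Minkowski

variable {Q : Type*} [Field Q] {d : ℕ} [NeZero d]

/-- The Minkowski bilinear form of signature `(1, d - 1)`. -/
def minkForm (Q : Type*) [Field Q] (d : ℕ) [NeZero d] : LinearMap.BilinForm Q (Fin d → Q) :=
  LinearMap.mk₂ Q (fun p q => p 0 * q 0 - ∑ i : {i : Fin d // i ≠ 0}, p i * q i)
    (fun p p' q => by simp only [Pi.add_apply, add_mul, Finset.sum_add_distrib]; ring)
    (fun c p q => by simp only [Pi.smul_apply, smul_eq_mul, mul_assoc, ← Finset.mul_sum]; ring)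
    (fun p q q' => by simp only [Pi.add_apply, mul_add, Finset.sum_add_distrib]; ring)
    (fun c p q => by
      simp only [Pi.smul_apply, smul_eq_mul, mul_left_comm _ c, ← Finset.mul_sum]; ring)

theorem minkForm_apply (p q : Fin d → Q) :
    minkForm Q d p q = p 0 * q 0 - ∑ i : {i : Fin d // i ≠ 0}, p i * q i := rfl

theorem minkForm_comm (p q : Fin d → Q) : minkForm Q d p q = minkForm Q d q p := by
  simp only [minkForm_apply, mul_comm]

theorem minkForm_single_zero (s : Q) (p : Fin d → Q) :
    minkForm Q d (Pi.single 0 s) p = s * p 0 := by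
  rw [minkForm_apply, Finset.sum_eq_zero]
  · simp
  · rintro ⟨i, hi⟩ -
    simp [hi]

theorem minkForm_single_of_ne {i : Fin d} (hi : i ≠ 0) (s : Q) (p : Fin d → Q) :
    minkForm Q d (Pi.single i s) p = -(s * p i) := by
  rw [minkForm_apply, Finset.sum_eq_single ⟨i, hi⟩]
  · simp [hi.symm]
  · rintro ⟨j, hj⟩ - h
    have : j ≠ i := fun h' => h (Subtype.ext h')
    simp [this]
  · simp

/-- A vector is null if its Minkowski square vanishes. -/
def IsNull (v : Fin d → Q) : Prop := minkForm Q d v v = 0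

theorem minkForm_add_self (v w : Fin d → Q) : minkForm Q d (v + w) (v + w) =
    minkForm Q d v v + 2 * minkForm Q d v w + minkForm Q d w w := by
  simp only [map_add, LinearMap.add_apply, minkForm_comm w v]; ring

theorem minkForm_sub_self (v w : Fin d → Q) : minkForm Q d (v - w) (v - w) =
    minkForm Q d v v - 2 * minkForm Q d v w + minkForm Q d w w := by
  simp only [map_sub, LinearMap.sub_apply, minkForm_comm w v]; ring

theorem minkForm_smul_smul (s t : Q) (v w : Fin d → Q) :
    minkForm Q d (s • v) (t • w) = s * t * minkForm Q d v w := by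
  simp only [map_smul, LinearMap.smul_apply, smul_eq_mul]; ring

theorem IsNull.smul {v : Fin d → Q} (h : IsNull v) (t : Q) : IsNull (t • v) := by
  rw [IsNull, minkForm_smul_smul, h, mul_zero]

theorem isNull_zero : IsNull (0 : Fin d → Q) := by simp [IsNull]

theorem minkForm_self_of_time_zero {v : Fin d → Q} (h0 : v 0 = 0) :
    minkForm Q d v v = -∑ i : {i : Fin d // i ≠ 0}, v i ^ 2 := by
  simp [minkForm_apply, h0, sq]

theorem minkForm_axis_axis {i j : Fin d} (hi : i ≠ 0) (hj : j ≠ 0) (a b c e : Q) :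
    minkForm Q d (Pi.single 0 a + Pi.single i b) (Pi.single 0 c + Pi.single j e) =
      a * c - if i = j then b * e else 0 := by
  simp only [map_add, LinearMap.add_apply, minkForm_single_zero, minkForm_single_of_ne hi,
    Pi.single_eq_same, Pi.single_eq_of_ne hi, Pi.single_eq_of_ne hj.symm]
  by_cases h : i = j
  · subst h; simp; ring
  · simp [h]

theorem axis_ne_zero {i : Fin d} (hi : i ≠ 0) {a : Q} (ha : a ≠ 0) (b : Q) :
    (Pi.single 0 a + Pi.single i b : Fin d → Q) ≠ 0 := by
  intro h
  have := congrFun h 0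
  simp [Pi.single_eq_of_ne hi.symm] at this
  exact ha this

/-- `f` preserves null separation of points in both directions. -/
def PreservesNull (f : (Fin d → Q) → (Fin d → Q)) : Prop :=
  ∀ x y, IsNull (f x - f y) ↔ IsNull (x - y)

theorem PreservesNull.isNull_add {f : (Fin d → Q) → (Fin d → Q)} (hf : PreservesNull f)
    (x : Fin d → Q) {n : Fin d → Q} (hn : IsNull n) : IsNull (f (x + n) - f x) :=
  (hf _ _).2 (by rwa [add_sub_cancel_left])

variable [LinearOrder Q] [IsStrictOrderedRing Q]

theorem IsNull.add_iff {v w : Fin d → Q} (hv : IsNull v) (hw : IsNull w) :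
    IsNull (v + w) ↔ minkForm Q d v w = 0 := by
  rw [IsNull, minkForm_add_self, hv, hw]; simp

theorem IsNull.sub_iff {v w : Fin d → Q} (hv : IsNull v) (hw : IsNull w) :
    IsNull (v - w) ↔ minkForm Q d v w = 0 := by
  rw [IsNull, minkForm_sub_self, hv, hw]; simp

theorem IsNull.eq_zero {v : Fin d → Q} (h : IsNull v) (h0 : v 0 = 0) : v = 0 := by
  rw [IsNull, minkForm_self_of_time_zero h0, neg_eq_zero,
    Finset.sum_eq_zero_iff_of_nonneg fun _ _ => sq_nonneg _] at h
  funext i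
  by_cases hi : i = 0
  · rw [hi, h0]; rfl
  · exact pow_eq_zero_iff two_ne_zero |>.1 (h ⟨i, hi⟩ (Finset.mem_univ _))

/-- Orthogonal null vectors are collinear. -/
theorem IsNull.exists_smul_eq {n z : Fin d → Q} (hn : IsNull n) (hn0 : n ≠ 0) (hz : IsNull z)
    (h : minkForm Q d z n = 0) : ∃ t : Q, z = t • n := by
  have h0 : n 0 ≠ 0 := fun h => hn0 (hn.eq_zero h)
  refine ⟨z 0 / n 0, sub_eq_zero.1 (IsNull.eq_zero ((hz.sub_iff (hn.smul _)).2 ?_) ?_)⟩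
  · rw [map_smul, h, smul_zero]
  · simp [h0]

/-- The null vectors with one spatial direction along a coordinate axis. -/
theorem isNull_axis {i : Fin d} (hi : i ≠ 0) (s t : Q) (h : s ^ 2 = t ^ 2) :
    IsNull (Pi.single 0 s + Pi.single i t : Fin d → Q) := by
  rw [IsNull, minkForm_add_self]
  simp only [minkForm_single_zero, minkForm_single_of_ne hi, Pi.single_eq_same,
    Pi.single_eq_of_ne hi.symm]
  linear_combination h

theorem isNull_plane {i j : Fin d} (hi : i ≠ 0) (hj : j ≠ 0) (hij : i ≠ j) (a b c : Q)
    (h : a ^ 2 = b ^ 2 + c ^ 2) :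
    IsNull (Pi.single 0 a + Pi.single i b + Pi.single j c : Fin d → Q) := by
  rw [IsNull, minkForm_add_self, minkForm_add_self]
  simp only [map_add, LinearMap.add_apply, minkForm_single_zero, minkForm_single_of_ne hi,
    minkForm_single_of_ne hj, Pi.single_eq_same, Pi.single_eq_of_ne hi.symm,
    Pi.single_eq_of_ne hj.symm, Pi.single_eq_of_ne hij]
  linear_combination h

/-- Orthogonality to both `e₀ + eᵢ` and `e₀ - eᵢ` kills the time component of `n`, and a null vector
without time component is zero. -/
theorem exists_isNull_minkForm_ne_zero {i : Fin d} (hi : i ≠ 0) {n : Fin d → Q} (hn : IsNull n)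
    (hn0 : n ≠ 0) : ∃ m : Fin d → Q, IsNull m ∧ minkForm Q d m n ≠ 0 := by
  by_contra! H
  have h1 := H _ (isNull_axis hi 1 1 rfl)
  have h2 := H _ (isNull_axis hi 1 (-1) (by ring))
  simp only [map_add, LinearMap.add_apply, minkForm_single_zero, minkForm_single_of_ne hi] at h1 h2
  exact hn0 (hn.eq_zero (by linarith))

/-- Additive subgroups containing the null vectors spanned by the time axis and one spatial axis
are everything. -/
theorem eq_top_of_axis_mem {i : Fin d} (hi : i ≠ 0) (G : AddSubgroup (Fin d → Q))
    (h : ∀ i ≠ (0 : Fin d), ∀ t : Q, (Pi.single 0 t + Pi.single i t : Fin d → Q) ∈ G ∧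
      (Pi.single 0 t - Pi.single i t : Fin d → Q) ∈ G) (v : Fin d → Q) : v ∈ G := by
  have h0 : ∀ t : Q, (Pi.single 0 t : Fin d → Q) ∈ G := fun t => by
    have := G.add_mem (h i hi (t / 2)).1 (h i hi (t / 2)).2
    rwa [add_add_sub_cancel, ← Pi.single_add, add_halves] at this
  rw [← Finset.univ_sum_single v]
  refine G.sum_mem fun j _ => ?_
  by_cases hj : j = 0
  · subst hj; exact h0 _
  · have := G.sub_mem (h j hj (v j)).1 (h0 (v j))
    rwa [add_sub_cancel_left] at this

/-! ### Maps preserving null separation -/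

theorem PreservesNull.injective {i : Fin d} (hi : i ≠ 0) {f : (Fin d → Q) → (Fin d → Q)}
    (hf : PreservesNull f) : Function.Injective f := by
  intro x y hxy
  by_contra hne
  have hn : IsNull (x - y) := (hf x y).1 (by rw [hxy, sub_self]; exact isNull_zero)
  -- If `f x = f y`, then `x` and `y` have the same null-separated points; so `x - y + m` is null
  -- for every null `m`, which makes every null `m` orthogonal to `x - y`.
  obtain ⟨m, hm, hmn⟩ := exists_isNull_minkForm_ne_zero hi hn (sub_ne_zero.2 hne)
  apply hmn
  rw [← hm.add_iff hn]
  have h : IsNull (x + m - x) := by rwa [add_sub_cancel_left]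
  rw [← hf, hxy, hf] at h
  rwa [add_comm x, add_sub_assoc] at h

/-- Light lines are mapped into light lines. -/
theorem PreservesNull.map_add_smul {i : Fin d} (hi : i ≠ 0) {f : (Fin d → Q) → (Fin d → Q)}
    (hf : PreservesNull f) (x : Fin d → Q) {n : Fin d → Q} (hn : IsNull n) (hn0 : n ≠ 0) (t : Q) :
    ∃ s : Q, f (x + t • n) = f x + s • (f (x + n) - f x) := by
  have h1 := hf.isNull_add x hn
  have h2 := hf.isNull_add x (hn.smul t)
  -- The three image points are pairwise null separated, so their displacements from `f x` are
  -- orthogonal null vectors, hence collinear.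
  have h3 : IsNull (f (x + t • n) - f (x + n)) := by
    rw [hf, add_sub_add_left_eq_sub, hn.smul t |>.sub_iff hn, map_smul, LinearMap.smul_apply, hn,
      smul_zero]
  rw [← sub_sub_sub_cancel_right _ _ (f x), h2.sub_iff h1] at h3
  obtain ⟨s, hs⟩ := h1.exists_smul_eq
    (sub_ne_zero.2 fun h => hn0 (by simpa using hf.injective hi h)) h2 h3
  exact ⟨s, by rw [← hs, add_sub_cancel]⟩

/-- Light lines are mapped onto light lines. -/
theorem PreservesNull.exists_map_add_smul
    {f : (Fin d → Q) → (Fin d → Q)} (hf : PreservesNull f) (hs : Function.Surjective f)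
    (x : Fin d → Q) {n : Fin d → Q} (hn : IsNull n) (hn0 : n ≠ 0) (s : Q) :
    ∃ t : Q, f (x + t • n) = f x + s • (f (x + n) - f x) := by
  obtain ⟨z, hz⟩ := hs (f x + s • (f (x + n) - f x))
  have h1 := hf.isNull_add x hn
  have h2 : IsNull (z - x) := by
    rw [← hf, hz, add_sub_cancel_left]; exact h1.smul s
  have h3 : IsNull ((z - x) - n) := by
    rw [sub_sub, ← hf, hz, ← sub_sub_sub_cancel_right _ _ (f x), add_sub_cancel_left,
      (h1.smul s).sub_iff h1, map_smul, LinearMap.smul_apply, h1, smul_zero]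
  obtain ⟨t, ht⟩ := hn.exists_smul_eq hn0 h2 ((h2.sub_iff hn).1 h3)
  exact ⟨t, by rw [← ht, add_sub_cancel, hz]⟩

/-! ### Additivity of null-preserving surjections -/

/-- Parallelograms with null sides are mapped to parallelograms. -/
theorem PreservesNull.parallelogram {i : Fin d} (hi : i ≠ 0) {f : (Fin d → Q) → (Fin d → Q)}
    (hf : PreservesNull f) (hs : Function.Surjective f) (x : Fin d → Q) {n m : Fin d → Q}
    (hn : IsNull n) (hm : IsNull m) (hnm : minkForm Q d n m ≠ 0) :
    f (x + m + n) - f (x + m) = f (x + n) - f x := by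
  have hn0 : n ≠ 0 := by rintro rfl; simp at hnm
  have hm0 : m ≠ 0 := by rintro rfl; simp at hnm
  set n' := f (x + n) - f x with hn'
  set m' := f (x + m) - f x with hm'
  set p' := f (x + m + n) - f (x + m) with hp'
  have Nn : IsNull n' := hf.isNull_add x hn
  have Nm : IsNull m' := hf.isNull_add x hm
  have Np : IsNull p' := hf.isNull_add (x + m) hn
  have hnm' : minkForm Q d n' m' ≠ 0 := by
    rw [Ne, ← Nn.sub_iff Nm, hn', hm', sub_sub_sub_cancel_right, hf, add_sub_add_left_eq_sub,
      hn.sub_iff hm]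
    exact hnm
  have hmp : minkForm Q d m' p' ≠ 0 := by
    rw [Ne, ← Nm.add_iff Np, hm', hp', add_comm, sub_add_sub_cancel, hf, add_assoc,
      add_sub_cancel_left, hm.add_iff hn, minkForm_comm]
    exact hnm
  have hn'0 : n' ≠ 0 := by intro h; simp [h] at hnm'
  have hpn : minkForm Q d p' n' = 0 := by
    by_contra hpn
    -- The multiple `r` is chosen so that the unknown `s` drops out of the square of `m' + s p' - r
    -- n'`, leaving `-2 r ⟨m', n'⟩`, which is nonzero although the vector is null.
    obtain ⟨t, ht⟩ := hf.exists_map_add_smul hs x hn hn0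
      (minkForm Q d m' p' / minkForm Q d p' n')
    obtain ⟨s, hs'⟩ := hf.map_add_smul hi (x + m) hn hn0 t
    rw [← hp'] at hs'
    rw [← hn'] at ht
    set r := minkForm Q d m' p' / minkForm Q d p' n' with hr
    have hr' : r * minkForm Q d p' n' = minkForm Q d m' p' := div_mul_cancel₀ _ hpn
    have hr0 : r ≠ 0 := div_ne_zero hmp hpn
    have key : IsNull (m' + s • p' - r • n') := by
      have : m' + s • p' - r • n' = f (x + m + t • n) - f (x + t • n) := by
        rw [ht, hs', hm']; abel
      rw [this, hf, add_right_comm, add_sub_cancel_left]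
      exact hm
    rw [IsNull, minkForm_sub_self, minkForm_add_self, Nm, minkForm_smul_smul, minkForm_smul_smul,
      Np, Nn] at key
    simp only [map_add, map_smul, LinearMap.add_apply, LinearMap.smul_apply, smul_eq_mul] at key
    have : r * minkForm Q d m' n' = 0 := by linear_combination (-1 / 2) * key - s * hr'
    rw [minkForm_comm] at this
    exact (mul_ne_zero hr0 hnm') this
  obtain ⟨l, hl⟩ := Nn.exists_smul_eq hn'0 Np hpn
  -- The side opposite to `m'` is also null, and this fixes the ratio `l` of the parallel sides to
  -- be `1`.
  have h1 : IsNull (m' + (l - 1) • n') := by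
    have : m' + (l - 1) • n' = f (x + m + n) - f (x + n) := by
      rw [sub_smul, ← hl, one_smul, hm', hp', hn']; abel
    rw [this, hf, add_right_comm, add_sub_cancel_left]
    exact hm
  rw [Nm.add_iff (Nn.smul _), map_smul, smul_eq_mul, minkForm_comm m'] at h1
  have hl1 : l = 1 := by
    rcases mul_eq_zero.1 h1 with h | h
    · linarith
    · exact absurd h hnm'
  rw [hl, hl1, one_smul]

/-- The vectors `v` such that translating the base point by `v` does not change the displacement
of `f` along `n`. -/
def displacementSubgroup (f : (Fin d → Q) → (Fin d → Q)) (n : Fin d → Q) :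
    AddSubgroup (Fin d → Q) where
  carrier := {v | ∀ x, f (x + v + n) - f (x + v) = f (x + n) - f x}
  zero_mem' := by simp
  add_mem' := by
    intro v w hv hw x
    rw [← add_assoc, hw (x + v), hv x]
  neg_mem' := by
    intro v hv x
    simpa using (hv (x + -v)).symm

/-- The vectors along which the displacement of `f` does not depend on the base point. -/
def constDisplacementSubgroup (f : (Fin d → Q) → (Fin d → Q)) : AddSubgroup (Fin d → Q) where
  carrier := {n | ∀ x, f (x + n) - f x = f n - f 0}
  zero_mem' := by simp
  add_mem' := by
    intro v w hv hw x
    have h1 := hw (x + v)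
    have h2 := hw v
    rw [← add_assoc, ← sub_add_sub_cancel _ (f (x + v)), h1, hv x, ← h2, sub_add_sub_cancel]
  neg_mem' := by
    intro v hv x
    have h1 := hv (x + -v)
    have h2 := hv (-v)
    rw [neg_add_cancel_right] at h1
    rw [neg_add_cancel] at h2
    rw [← neg_sub (f x), h1, ← h2, neg_sub]

/-- By `parallelogram`, translation by a null vector not orthogonal to the given one leaves the
displacement unchanged, and such vectors generate everything. On the axis `i` itself only one of the
two null directions qualifies; a second spatial axis supplies the time vectors that make up for the
other. -/
theorem PreservesNull.displacement_axis {f : (Fin d → Q) → (Fin d → Q)} (hf : PreservesNull f)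
    (hs : Function.Surjective f) (hd : 3 ≤ d) {i : Fin d} (hi : i ≠ 0) (a b : Q)
    (hab : b = a ∨ b = -a) (v : Fin d → Q) :
    v ∈ displacementSubgroup f (Pi.single 0 a + Pi.single i b) := by
  by_cases ha : a = 0
  · have hb : b = 0 := by simpa [ha] using hab
    subst ha hb
    intro x
    simp
  obtain ⟨j, hj, hij⟩ : ∃ j : Fin d, j ≠ 0 ∧ i ≠ j := by
    by_contra! H
    have h1 := H ⟨1, by omega⟩ (by simp [Fin.ext_iff])
    have h2 := H ⟨2, by omega⟩ (by simp [Fin.ext_iff])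
    simp [h1, Fin.ext_iff] at h2
  have key : ∀ l ≠ (0 : Fin d), ∀ c e : Q, (e = c ∨ e = -c) → (i = l → b * e = -(a * c)) →
      (Pi.single 0 c + Pi.single l e : Fin d → Q) ∈
        displacementSubgroup f (Pi.single 0 a + Pi.single i b) := by
    intro l hl c e hce hil x
    by_cases hc : c = 0
    · have he : e = 0 := by simpa [hc] using hce
      subst hc he
      simp
    refine hf.parallelogram hi hs x (isNull_axis hi a b ?_) (isNull_axis hl c e ?_) ?_
    · rcases hab with h | h <;> rw [h]; ring
    · rcases hce with h | h <;> rw [h]; ring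
    · rw [minkForm_axis_axis hi hl]
      split_ifs with h
      · rw [hil h]
        intro h'
        exact mul_ne_zero ha hc (by linarith)
      · simpa using ⟨ha, hc⟩
  have h0 : ∀ t : Q, (Pi.single 0 t : Fin d → Q) ∈
        displacementSubgroup f (Pi.single 0 a + Pi.single i b) := fun t => by
    have := AddSubgroup.add_mem _ (key j hj (t / 2) (t / 2) (Or.inl rfl) (absurd · hij))
      (key j hj (t / 2) (-(t / 2)) (Or.inr rfl) (absurd · hij))
    rwa [Pi.single_neg, ← sub_eq_add_neg, add_add_sub_cancel, ← Pi.single_add, add_halves] at this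
  refine eq_top_of_axis_mem hi _ (fun l hl t => ?_) v
  suffices h : (Pi.single l t : Fin d → Q) ∈
      displacementSubgroup f (Pi.single 0 a + Pi.single i b) from
    ⟨AddSubgroup.add_mem _ (h0 t) h, AddSubgroup.sub_mem _ (h0 t) h⟩
  by_cases hil : i = l
  · rcases hab with h | h
    · have := AddSubgroup.sub_mem _ (h0 t) (key l hl t (-t) (Or.inr rfl) fun _ => by rw [h]; ring)
      rwa [Pi.single_neg, ← sub_eq_add_neg, sub_sub_cancel] at this
    · have := AddSubgroup.sub_mem _ (key l hl t t (Or.inl rfl) fun _ => by rw [h]; ring) (h0 t)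
      rwa [add_sub_cancel_left] at this
  · have := AddSubgroup.sub_mem _ (key l hl t t (Or.inl rfl) (absurd · hil)) (h0 t)
    rwa [add_sub_cancel_left] at this

/-- Surjections preserving null separation are additive up to a translation. -/
theorem PreservesNull.exists_addMonoidHom {f : (Fin d → Q) → (Fin d → Q)} (hf : PreservesNull f)
    (hs : Function.Surjective f) (hd : 3 ≤ d) :
    ∃ g : (Fin d → Q) →+ (Fin d → Q), ∀ x y, f x - f y = g (x - y) := by
  have hi : (⟨1, by omega⟩ : Fin d) ≠ 0 := by simp [Fin.ext_iff]
  have key : ∀ v, v ∈ constDisplacementSubgroup f := by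
    refine fun v => eq_top_of_axis_mem hi _ (fun i hi t => ⟨fun x => ?_, fun x => ?_⟩) v
    · simpa using hf.displacement_axis hs hd hi t t (Or.inl rfl) x 0
    · simpa [sub_eq_add_neg, Pi.single_neg] using
        hf.displacement_axis hs hd hi t (-t) (Or.inr rfl) x 0
  refine ⟨AddMonoidHom.mk' (fun v => f v - f 0) fun v w => ?_, fun x y => ?_⟩
  · rw [← key w v, sub_add_sub_cancel']
  · have := key (x - y) y
    rwa [add_sub_cancel] at this

end Minkowski

/-! ### From additive null-preserving maps to Lorentz transformations -/

section Lorentz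

variable {Q : Type*} [Field Q] {d : ℕ}

theorem AddMonoidHom.map_single_natCast (g : (Fin d → Q) →+ (Fin d → Q)) (i : Fin d) (n : ℕ) :
    g (Pi.single i (n : Q)) = (n : Q) • g (Pi.single i 1) := by
  rw [← map_natCast_smul g Q Q, ← Pi.single_smul, smul_eq_mul, mul_one]

theorem single_eq_smul (i : Fin d) (t : Q) : (Pi.single i t : Fin d → Q) = t • Pi.single i 1 := by
  rw [← Pi.single_smul, smul_eq_mul, mul_one]

variable [NeZero d]

theorem PreservesNull.isNull_map_iff {g : (Fin d → Q) →+ (Fin d → Q)} (hg : PreservesNull g)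
    (v : Fin d → Q) : IsNull (g v) ↔ IsNull v := by
  simpa using hg v 0

variable [LinearOrder Q] [IsStrictOrderedRing Q]

theorem PreservesNull.minkForm_time_ne_zero {g : (Fin d → Q) →+ (Fin d → Q)}
    (hg : PreservesNull g) :
    minkForm Q d (g (Pi.single 0 1)) (g (Pi.single 0 1)) ≠ 0 := fun h => by
  have := (hg.isNull_map_iff _).1 h
  rw [IsNull, minkForm_single_zero] at this
  simp at this

/-- Both `e₀ + eᵢ` and `e₀ - eᵢ` have null images; add and subtract the two equations. -/
theorem PreservesNull.minkForm_time_axis {g : (Fin d → Q) →+ (Fin d → Q)}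
    (hg : PreservesNull g) {i : Fin d} (hi : i ≠ 0) :
    minkForm Q d (g (Pi.single 0 1)) (g (Pi.single i 1)) = 0 ∧
      minkForm Q d (g (Pi.single i 1)) (g (Pi.single i 1)) =
        -minkForm Q d (g (Pi.single 0 1)) (g (Pi.single 0 1)) := by
  have h1 := (hg.isNull_map_iff _).2 (isNull_axis hi (1 : Q) 1 rfl)
  have h2 := (hg.isNull_map_iff _).2 (isNull_axis hi (1 : Q) (-1) (by ring))
  rw [Pi.single_neg, ← sub_eq_add_neg, map_sub, IsNull, minkForm_sub_self] at h2
  rw [map_add, IsNull, minkForm_add_self] at h1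
  constructor <;> linarith

/-- The Pythagorean triple `3, 4, 5` gives a null vector with natural coefficients, which an
additive map respects before any linearity is known. -/
theorem PreservesNull.minkForm_axis_orthogonal {g : (Fin d → Q) →+ (Fin d → Q)}
    (hg : PreservesNull g) {i j : Fin d} (hi : i ≠ 0) (hj : j ≠ 0) (hij : i ≠ j) :
    minkForm Q d (g (Pi.single i 1)) (g (Pi.single j 1)) = 0 := by
  have h := (hg.isNull_map_iff _).2
    (isNull_plane hi hj hij ((5 : ℕ) : Q) ((3 : ℕ) : Q) ((4 : ℕ) : Q) (by norm_num))
  rw [map_add, map_add, AddMonoidHom.map_single_natCast, AddMonoidHom.map_single_natCast,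
    AddMonoidHom.map_single_natCast, IsNull, minkForm_add_self, minkForm_add_self] at h
  simp only [map_add, map_smul, LinearMap.add_apply, LinearMap.smul_apply, smul_eq_mul,
    (hg.minkForm_time_axis hi).1, (hg.minkForm_time_axis hj).1, (hg.minkForm_time_axis hi).2,
    (hg.minkForm_time_axis hj).2] at h
  push_cast at h
  linarith

theorem exists_two_ne_zero (hd : 3 ≤ d) : ∃ i j : Fin d, i ≠ 0 ∧ j ≠ 0 ∧ i ≠ j :=
  ⟨⟨1, by omega⟩, ⟨2, by omega⟩, by simp [Fin.ext_iff], by simp [Fin.ext_iff],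
    by simp [Fin.ext_iff]⟩

/-- On a null direction, an additive map preserving null separation is given by some scaling. -/
theorem PreservesNull.exists_map_smul {g : (Fin d → Q) →+ (Fin d → Q)} (hg : PreservesNull g)
    {i : Fin d} (hi : i ≠ 0) {n : Fin d → Q} (hn : IsNull n) (hn0 : n ≠ 0) (t : Q) :
    ∃ s : Q, g (t • n) = s • g n := by
  simpa using hg.map_add_smul hi 0 hn hn0 t

/-- An additive map preserving null separation scales all coordinate axes in the same way. -/
theorem PreservesNull.exists_scaling {g : (Fin d → Q) →+ (Fin d → Q)} (hg : PreservesNull g)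
    (hd : 3 ≤ d) : ∃ φ : Q → Q, ∀ t i, g (Pi.single i t) = φ t • g (Pi.single i 1) := by
  have hc := hg.minkForm_time_ne_zero
  have key : ∀ t, ∀ i ≠ (0 : Fin d), ∃ a : Q, g (Pi.single 0 t) = a • g (Pi.single 0 1) ∧
      g (Pi.single i t) = a • g (Pi.single i 1) := by
    intro t i hi
    -- The null lines along `e₀ + eᵢ` and `e₀ - eᵢ` are scaled by possibly different factors; half
    -- their sum and half their difference give the two coefficients.
    have main : ∀ i ≠ (0 : Fin d), ∃ a b : Q,
        g (Pi.single 0 t) = a • g (Pi.single 0 1) + b • g (Pi.single i 1) ∧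
        g (Pi.single i t) = b • g (Pi.single 0 1) + a • g (Pi.single i 1) := by
      intro i hi
      obtain ⟨a, ha⟩ := hg.exists_map_smul hi (isNull_axis hi (1 : Q) 1 rfl)
        (axis_ne_zero hi one_ne_zero _) t
      obtain ⟨b, hb⟩ := hg.exists_map_smul hi (isNull_axis hi (1 : Q) (-1) (by ring))
        (axis_ne_zero hi one_ne_zero _) t
      rw [smul_add, ← single_eq_smul, ← single_eq_smul, map_add, map_add] at ha
      rw [smul_add, ← single_eq_smul, ← Pi.single_smul, smul_eq_mul, mul_neg_one, Pi.single_neg,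
        Pi.single_neg, map_add, map_add, map_neg, map_neg] at hb
      refine ⟨(a + b) / 2, (a - b) / 2, ?_, ?_⟩
      · have : g (Pi.single 0 t) = (1 / 2 : Q) • ((g (Pi.single 0 t) + g (Pi.single i t)) +
            (g (Pi.single 0 t) + -g (Pi.single i t))) := by module
        rw [this, ha, hb]; module
      · have : g (Pi.single i t) = (1 / 2 : Q) • ((g (Pi.single 0 t) + g (Pi.single i t)) -
            (g (Pi.single 0 t) + -g (Pi.single i t))) := by module
        rw [this, ha, hb]; module
    obtain ⟨j, hj, hij⟩ : ∃ j : Fin d, j ≠ 0 ∧ i ≠ j := by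
      obtain ⟨j, l, hj, hl, hjl⟩ := exists_two_ne_zero hd
      by_cases h : i = j
      · exact ⟨l, hl, h ▸ hjl⟩
      · exact ⟨j, hj, h⟩
    obtain ⟨a, b, h0, h1⟩ := main i hi
    obtain ⟨a', b', h0', -⟩ := main j hj
    -- Computing the image of `t e₀` through another axis `j` gives no component along `g eᵢ`.
    have hb : b = 0 := by
      have := congrArg (minkForm Q d (g (Pi.single i 1))) (h0.symm.trans h0')
      simp only [map_add, map_smul, smul_eq_mul, minkForm_comm _ (g (Pi.single 0 1)),
        (hg.minkForm_time_axis hi).1, (hg.minkForm_time_axis hi).2,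
        hg.minkForm_axis_orthogonal hi hj hij] at this
      simpa [hc] using this
    subst hb
    exact ⟨a, by simpa using h0, by simpa using h1⟩
  have hA : g (Pi.single 0 1) ≠ 0 := fun h => hc (by simp [h])
  have key2 : ∀ t, ∃ a : Q, ∀ i, g (Pi.single i t) = a • g (Pi.single i 1) := by
    intro t
    obtain ⟨j, -, hj, -, -⟩ := exists_two_ne_zero hd
    obtain ⟨a, ha, -⟩ := key t j hj
    refine ⟨a, fun i => ?_⟩
    by_cases hi : i = 0
    · rw [hi, ha]
    · obtain ⟨b, hb, hb'⟩ := key t i hi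
      rw [hb', smul_left_injective Q hA (ha.symm.trans hb)]
  choose φ hφ using key2
  exact ⟨φ, hφ⟩

/-- The scaling is multiplicative. -/
theorem PreservesNull.scaling_mul {g : (Fin d → Q) →+ (Fin d → Q)} (hg : PreservesNull g)
    (hQ : IsEuclideanField Q) (hd : 3 ≤ d) {φ : Q → Q}
    (hφ : ∀ t i, g (Pi.single i t) = φ t • g (Pi.single i 1)) (s t : Q) :
    φ (s * t) = φ s * φ t := by
  have hc := hg.minkForm_time_ne_zero
  have hA : g (Pi.single 0 1) ≠ 0 := fun h => hc (by simp [h])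
  have h1 : φ 1 = 1 :=
    smul_left_injective Q hA (show φ 1 • _ = (1 : Q) • _ by rw [← hφ, one_smul])
  obtain ⟨i, j, hi, hj, hij⟩ := exists_two_ne_zero hd
  -- Square roots complete `b` to a null vector `e₀ + b eᵢ + e eⱼ`. Its multiple by `t` is mapped to
  -- a multiple `r` of its image: the time coefficient gives `r = φ t`, the one along `g eᵢ` gives
  -- the claim.
  have key : ∀ t b : Q, |b| ≤ 1 → φ (t * b) = φ t * φ b := by
    intro t b hb
    obtain ⟨e, he⟩ : ∃ e : Q, e * e = 1 - b ^ 2 := by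
      rcases (sub_nonneg.2 ((sq_le_one_iff_abs_le_one b).2 hb)).eq_or_lt with h | h
      · exact ⟨0, by rw [← h, mul_zero]⟩
      · exact hQ _ h
    have hn := isNull_plane hi hj hij (1 : Q) b e (by linear_combination -he)
    obtain ⟨r, hr⟩ := hg.exists_map_smul hi hn (fun h => by
      have := congrFun h 0
      simp [Pi.single_eq_of_ne hi.symm, Pi.single_eq_of_ne hj.symm] at this) t
    simp only [smul_add, ← Pi.single_smul, smul_eq_mul, map_add] at hr
    rw [hφ (t * 1), hφ (t * b), hφ (t * e), hφ b, hφ e] at hr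
    have e0 := congrArg (minkForm Q d (g (Pi.single 0 1))) hr
    have e1 := congrArg (minkForm Q d (g (Pi.single i 1))) hr
    simp only [map_add, map_smul, smul_eq_mul, (hg.minkForm_time_axis hi).1,
      (hg.minkForm_time_axis hj).1] at e0
    simp only [map_add, map_smul, smul_eq_mul, minkForm_comm _ (g (Pi.single 0 1)),
      (hg.minkForm_time_axis hi).1, (hg.minkForm_time_axis hi).2,
      hg.minkForm_axis_orthogonal hi hj hij] at e1
    have e0' : φ t = r := mul_right_cancel₀ hc (by simpa using e0)
    rw [e0']
    exact mul_right_cancel₀ hc (by linear_combination -e1)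
  rcases le_total |t| 1 with h | h
  · exact key s t h
  · have ht : t ≠ 0 := by rintro rfl; simp at h; linarith
    have ht' : |t⁻¹| ≤ 1 := by rw [abs_inv]; exact inv_le_one_of_one_le₀ h
    -- For `|t| ≥ 1`, the bounded case is applied to the factor `t⁻¹` instead.
    have k1 := key (s * t) t⁻¹ ht'
    have k2 := key t t⁻¹ ht'
    rw [mul_inv_cancel_right₀ ht] at k1
    rw [mul_inv_cancel₀ ht, h1] at k2
    rw [k1]
    linear_combination φ (s * t) * k2

/-- Light lines are mapped onto light lines, and along such a line `g` acts by `φ`. -/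
theorem PreservesNull.scaling_surjective {g : (Fin d → Q) →+ (Fin d → Q)} (hg : PreservesNull g)
    (hs : Function.Surjective g) (hd : 3 ≤ d) {φ : Q → Q}
    (hφ : ∀ t i, g (Pi.single i t) = φ t • g (Pi.single i 1)) : Function.Surjective φ := by
  intro s
  obtain ⟨i, -, hi, -, -⟩ := exists_two_ne_zero hd
  have hn := isNull_axis hi (1 : Q) 1 rfl
  have hn0 := axis_ne_zero hi (one_ne_zero (α := Q)) 1
  obtain ⟨t, ht⟩ := hg.exists_map_add_smul hs 0 hn hn0 s
  refine ⟨t, ?_⟩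
  have h0 : g (Pi.single 0 1 + Pi.single i 1) ≠ 0 := fun h =>
    hn0 (hg.injective hi (h.trans (map_zero g).symm))
  rw [map_zero, zero_add, zero_add, zero_add, sub_zero, smul_add, ← single_eq_smul,
    ← single_eq_smul, map_add, hφ t, hφ t, ← smul_add, ← map_add] at ht
  exact smul_left_injective Q h0 ht

/-- If moreover `g` preserves the length of spatial vectors with spatial image, then `g` is a
Lorentz transformation. -/
theorem PreservesNull.exists_lorentz {g : (Fin d → Q) →+ (Fin d → Q)} (hg : PreservesNull g)
    (hs : Function.Surjective g) (hQ : IsEuclideanField Q) (hd : 3 ≤ d)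
    (hdist : ∀ v, v 0 = 0 → g v 0 = 0 → minkForm Q d (g v) (g v) = minkForm Q d v v) :
    ∃ L : (Fin d → Q) →ₗ[Q] (Fin d → Q), (∀ v, L v = g v) ∧
      ∀ v, minkForm Q d (L v) (L v) = minkForm Q d v v := by
  obtain ⟨φ, hφ⟩ := hg.exists_scaling hd
  have hmul := hg.scaling_mul hQ hd hφ
  have hsurj := hg.scaling_surjective hs hd hφ
  have hsmul : ∀ t v, g (t • v) = φ t • g v := by
    intro t v
    conv_lhs => rw [← Finset.univ_sum_single v]
    conv_rhs => rw [← Finset.univ_sum_single v]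
    simp only [Finset.smul_sum, map_sum]
    refine Finset.sum_congr rfl fun i _ => ?_
    rw [← Pi.single_smul, smul_eq_mul, hφ (t * v i), hφ (v i), hmul, mul_smul]
  obtain ⟨i, j, hi, hj, hij⟩ := exists_two_ne_zero hd
  -- In the plane of two spatial axes, surjectivity of `φ` allows the time components of the images
  -- to cancel. All multiples of `v` stay spatial with spatial image, so `hdist` controls `φ`.
  obtain ⟨v, hv0, hgv0, hv⟩ : ∃ v : Fin d → Q, v 0 = 0 ∧ g v 0 = 0 ∧ v ≠ 0 := by
    by_cases h : g (Pi.single i 1) 0 = 0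
    · exact ⟨Pi.single i 1, by simp [Pi.single_eq_of_ne hi.symm], h, by simp⟩
    · obtain ⟨a, ha⟩ := hsurj (g (Pi.single j 1) 0)
      obtain ⟨b, hb⟩ := hsurj (-g (Pi.single i 1) 0)
      refine ⟨Pi.single i a + Pi.single j b, ?_, ?_, ?_⟩
      · simp [Pi.single_eq_of_ne hi.symm, Pi.single_eq_of_ne hj.symm]
      · rw [map_add, hφ a, hφ b, ha, hb]
        simp only [Pi.add_apply, Pi.smul_apply, smul_eq_mul]
        ring
      · intro h'
        have := congrFun h' j
        simp [Pi.single_eq_of_ne hij.symm] at this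
        have h0 : φ 0 = 0 := by
          have := hφ 0 i
          rw [Pi.single_zero, map_zero] at this
          have := congrFun this 0
          simpa [h] using this.symm
        rw [this, h0] at hb
        exact h (by linarith)
  have hvv : minkForm Q d v v ≠ 0 := fun h => hv (IsNull.eq_zero h hv0)
  have hsq : ∀ t, φ t ^ 2 = t ^ 2 := by
    intro t
    have := hdist (t • v) (by simp [hv0]) (by simp [hsmul, hgv0])
    rw [hsmul, minkForm_smul_smul, minkForm_smul_smul, hdist v hv0 hgv0] at this
    linear_combination mul_right_cancel₀ hvv this
  have hadd : ∀ s t, φ (s + t) = φ s + φ t := by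
    intro s t
    have hA : g (Pi.single 0 1) ≠ 0 := fun h => hg.minkForm_time_ne_zero (by simp [h])
    refine smul_left_injective Q hA ?_
    change φ (s + t) • _ = (φ s + φ t) • _
    rw [← hφ, add_smul, ← hφ, ← hφ, Pi.single_add, map_add]
  have h1 : φ 1 = 1 := by
    rcases sq_eq_sq_iff_eq_or_eq_neg.1 (hsq 1) with h | h
    · exact h
    · have := hmul 1 1
      rw [mul_one, h] at this
      linarith
  -- Expanding `φ (1 + t) ^ 2 = (1 + t) ^ 2` isolates the cross term and removes the sign ambiguity.
  have hid : ∀ t, φ t = t := by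
    intro t
    have e1 := hsq (1 + t)
    rw [hadd, h1] at e1
    linear_combination (1 / 2) * e1 - (1 / 2) * hsq t
  refine ⟨{ g with map_smul' := fun t v => ?_ }, fun v => rfl, ?_⟩
  · change g (t • v) = t • g v
    rw [hsmul, hid]
  set L : (Fin d → Q) →ₗ[Q] (Fin d → Q) := { g with map_smul' := _ }
  have hL : ∀ v, L v = g v := fun v => rfl
  set c := minkForm Q d (g (Pi.single 0 1)) (g (Pi.single 0 1)) with hcdef
  have hconf : (minkForm Q d).compl₁₂ L L = c • minkForm Q d := by
    refine LinearMap.BilinForm.ext_basis (Pi.basisFun Q (Fin d)) fun a b => ?_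
    simp only [Pi.basisFun_apply, LinearMap.compl₁₂_apply, LinearMap.smul_apply, hL, smul_eq_mul]
    by_cases ha : a = 0
    · subst ha
      rw [minkForm_single_zero]
      by_cases hb : b = 0
      · subst hb; simp [hcdef]
      · rw [(hg.minkForm_time_axis hb).1]; simp [Pi.single_eq_of_ne (Ne.symm hb)]
    · rw [minkForm_single_of_ne ha]
      by_cases hb : b = 0
      · subst hb
        rw [minkForm_comm, (hg.minkForm_time_axis ha).1]; simp [Pi.single_eq_of_ne ha]
      · by_cases hab : a = b
        · subst hab
          rw [(hg.minkForm_time_axis ha).2]; simp [hcdef]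
        · rw [hg.minkForm_axis_orthogonal ha hb hab]; simp [Pi.single_eq_of_ne hab]
  have hconf' : ∀ v, minkForm Q d (g v) (g v) = c * minkForm Q d v v := fun v =>
    congrArg (fun F : LinearMap.BilinForm Q (Fin d → Q) => F v v) hconf
  have hc1 : c = 1 := mul_right_cancel₀ hvv (by rw [← hconf', hdist v hv0 hgv0, one_mul])
  intro v
  rw [hL, hconf', hc1, one_mul]

end Lorentz

/-! ### Euclidean length -/

section Length

theorem spaceComp_sub {Q : Type*} [Field Q] {d : ℕ} [NeZero d] (p q : Fin d → Q) :
    spaceComp (p - q) = spaceComp p - spaceComp q := rfl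

variable {Q : Type*} [Field Q] [LinearOrder Q] [IsStrictOrderedRing Q]

theorem IsEuclideanField.exists_sqrt (hQ : IsEuclideanField Q) {x : Q} (hx : 0 ≤ x) :
    ∃ y : Q, 0 ≤ y ∧ y * y = x := by
  rcases hx.eq_or_lt with rfl | h
  · exact ⟨0, le_rfl, mul_zero 0⟩
  · obtain ⟨y, hy⟩ := hQ x h
    exact ⟨|y|, abs_nonneg y, by rw [abs_mul_abs_self, hy]⟩

theorem qsqrt_nonneg (x : Q) : 0 ≤ qsqrt x := by
  unfold qsqrt
  split_ifs with h
  · exact (Classical.choose_spec h).1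
  · exact le_rfl

theorem IsEuclideanField.sq_qsqrt (hQ : IsEuclideanField Q) {x : Q} (hx : 0 ≤ x) :
    qsqrt x ^ 2 = x := by
  have h := hQ.exists_sqrt hx
  rw [qsqrt, dif_pos h, sq]
  exact (Classical.choose_spec h).2

variable {ι : Type*} [Fintype ι]

theorem euclLength_nonneg (v : ι → Q) : 0 ≤ euclLength v := qsqrt_nonneg _

theorem IsEuclideanField.sq_euclLength (hQ : IsEuclideanField Q) (v : ι → Q) :
    euclLength v ^ 2 = ∑ i, v i ^ 2 :=
  hQ.sq_qsqrt (Finset.sum_nonneg fun _ _ => sq_nonneg _)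

theorem IsEuclideanField.abs_le_euclLength (hQ : IsEuclideanField Q) (v : ι → Q) (i : ι) :
    |v i| ≤ euclLength v := by
  rw [← abs_of_nonneg (euclLength_nonneg v), ← sq_le_sq, hQ.sq_euclLength]
  exact Finset.single_le_sum (f := fun i => v i ^ 2) (fun _ _ => sq_nonneg _) (Finset.mem_univ i)

theorem IsEuclideanField.euclLength_le_sum (hQ : IsEuclideanField Q) (v : ι → Q) :
    euclLength v ≤ ∑ i, |v i| := by
  rw [← abs_of_nonneg (euclLength_nonneg v),
    ← abs_of_nonneg (Finset.sum_nonneg fun i (_ : i ∈ Finset.univ) => abs_nonneg (v i)),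
    ← sq_le_sq, hQ.sq_euclLength]
  simpa only [sq_abs] using
    Finset.sum_sq_le_sq_sum_of_nonneg (s := Finset.univ) fun i _ => abs_nonneg (v i)

variable {d : ℕ}

/-- Linear maps are bounded. -/
theorem IsEuclideanField.exists_euclLength_map_le (hQ : IsEuclideanField Q)
    (L : (Fin d → Q) →ₗ[Q] (Fin d → Q)) :
    ∃ K : Q, 0 < K ∧ ∀ v, euclLength (L v) ≤ K * euclLength v := by
  have hC : 0 ≤ ∑ i, ∑ j, |L (Pi.single j 1) i| :=
    Finset.sum_nonneg fun _ _ => Finset.sum_nonneg fun _ _ => abs_nonneg _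
  refine ⟨∑ i, ∑ j, |L (Pi.single j 1) i| + 1, by linarith, fun v => ?_⟩
  have hLv : ∀ i, L v i = ∑ j, v j * L (Pi.single j 1) i := fun i => by
    conv_lhs => rw [← Finset.univ_sum_single v]
    simp only [map_sum, Finset.sum_apply]
    refine Finset.sum_congr rfl fun j _ => ?_
    rw [single_eq_smul, map_smul, Pi.smul_apply, smul_eq_mul]
  calc euclLength (L v) ≤ ∑ i, |L v i| := hQ.euclLength_le_sum _
    _ ≤ ∑ i, ∑ j, |L (Pi.single j 1) i| * euclLength v := by
      refine Finset.sum_le_sum fun i _ => ?_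
      rw [hLv]
      refine (Finset.abs_sum_le_sum_abs _ _).trans (Finset.sum_le_sum fun j _ => ?_)
      rw [abs_mul, mul_comm]
      exact mul_le_mul_of_nonneg_left (hQ.abs_le_euclLength v j) (abs_nonneg _)
    _ = (∑ i, ∑ j, |L (Pi.single j 1) i|) * euclLength v := by
      simp only [Finset.sum_mul]
    _ ≤ _ := mul_le_mul_of_nonneg_right (by linarith) (euclLength_nonneg v)

/-- The derivative vector of a curve at a point of its domain is unique. -/
theorem IsCurve.derivVector_unique (hQ : IsEuclideanField Q) {γ : Set (Q × (Fin d → Q))}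
    (hγ : IsCurve γ) {t : Q} {v w : Fin d → Q} (hv : IsDerivVector γ t v)
    (hw : IsDerivVector γ t w) : v = w := by
  obtain ⟨hfun, hconn, hnt⟩ := hγ
  obtain ⟨p, hp, hv⟩ := hv
  obtain ⟨p', hp', hw⟩ := hw
  obtain rfl := hfun _ _ _ hp hp'
  obtain ⟨u, hu, hut⟩ := hnt.exists_ne t
  -- Connectedness together with a second point of the domain makes `t` an accumulation point of the
  -- domain.
  have near : ∀ δ : Q, 0 < δ → ∃ s ∈ relDom γ, s ≠ t ∧ |s - t| < δ := by
    intro δ hδ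
    rcases lt_or_gt_of_ne hut with h | h
    · obtain ⟨s, hs, hst⟩ := exists_between (max_lt h (sub_lt_self t hδ))
      refine ⟨s, hconn.out hu ⟨p, hp⟩ ⟨(le_max_left _ _).trans hs.le, hst.le⟩, hst.ne, ?_⟩
      rw [abs_lt]
      constructor <;> linarith [(le_max_right _ _).trans_lt hs]
    · obtain ⟨s, hs, hst⟩ := exists_between (lt_min h (lt_add_of_pos_right t hδ))
      refine ⟨s, hconn.out ⟨p, hp⟩ hu ⟨hs.le, hst.le.trans (min_le_left _ _)⟩, hs.ne', ?_⟩
      rw [abs_lt]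
      constructor <;> linarith [hst.trans_le (min_le_right _ _)]
  funext i
  refine sub_eq_zero.1 (abs_nonpos_iff.1 (le_of_forall_pos_le_add fun ε hε => ?_))
  obtain ⟨δ₁, hδ₁, h₁⟩ := hv (ε / 2) (half_pos hε)
  obtain ⟨δ₂, hδ₂, h₂⟩ := hw (ε / 2) (half_pos hε)
  obtain ⟨s, ⟨r, hr⟩, hst, hsδ⟩ := near _ (lt_min hδ₁ hδ₂)
  have k₁ := (hQ.abs_le_euclLength _ i).trans (h₁ s r hr (hsδ.trans_le (min_le_left _ _)))
  have k₂ := (hQ.abs_le_euclLength _ i).trans (h₂ s r hr (hsδ.trans_le (min_le_right _ _)))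
  have hpos : 0 < |s - t| := abs_pos.2 (sub_ne_zero.2 hst)
  refine le_of_mul_le_mul_left ?_ hpos
  have : (s - t) * (v i - w i) =
      (r - p - (s - t) • w) i - (r - p - (s - t) • v) i := by
    simp only [Pi.sub_apply, Pi.smul_apply, smul_eq_mul]; ring
  rw [← abs_mul, this]
  refine (abs_sub _ _).trans ?_
  linarith

variable [NeZero d]

theorem IsEuclideanField.minkForm_self (hQ : IsEuclideanField Q) (v : Fin d → Q) :
    minkForm Q d v v = timeComp v ^ 2 - euclLength (spaceComp v) ^ 2 := by
  rw [hQ.sq_euclLength, minkForm_apply]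
  simp only [timeComp, spaceComp, sq]

theorem IsEuclideanField.isNull_sub_iff (hQ : IsEuclideanField Q) (p q : Fin d → Q) :
    IsNull (p - q) ↔ euclLength (spaceComp p - spaceComp q) = |timeComp p - timeComp q| := by
  rw [IsNull, hQ.minkForm_self, spaceComp_sub, sub_eq_zero, sq_eq_sq_iff_abs_eq_abs,
    abs_of_nonneg (euclLength_nonneg (spaceComp p - spaceComp q))]
  exact eq_comm

theorem IsEuclideanField.isTimelike_of_minkForm_eq_one (hQ : IsEuclideanField Q) {v : Fin d → Q}
    (h : minkForm Q d v v = 1) : IsTimelike v := by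
  rw [hQ.minkForm_self] at h
  rw [IsTimelike, ← abs_of_nonneg (euclLength_nonneg (spaceComp v)), ← sq_lt_sq]
  linarith

theorem IsEuclideanField.minkLength_of_minkForm_eq_one (hQ : IsEuclideanField Q) {v : Fin d → Q}
    (h : minkForm Q d v v = 1) : minkLength v = 1 := by
  rw [hQ.minkForm_self] at h
  rw [minkLength, if_pos (by linarith), h]
  exact (sq_eq_sq₀ (qsqrt_nonneg _) zero_le_one).1 (by rw [hQ.sq_qsqrt zero_le_one, one_pow])

end Length

/-! ### Worldview transformations and life-curves -/

namespace KinFrame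

variable {Q : Type*} [Field Q] [LinearOrder Q] [IsStrictOrderedRing Q] {d : ℕ} [NeZero d]
  {Body : Type*} {M : KinFrame Q d Body}

/-- `AxPh` with both points equal provides a photon at `p`. -/
theorem AccRel₀.ev_nonempty (hM : M.AccRel₀) {m : Body} (hm : m ∈ M.IOb) (p : Fin d → Q) :
    (M.ev m p).Nonempty := by
  obtain ⟨b, ⟨-, hb⟩, -⟩ := (hM.axPh m hm p p).1
    ((hM.axEOF.isNull_sub_iff p p).1 (by rw [sub_self]; exact isNull_zero))
  exact ⟨b, hb⟩

theorem AccRel₀.isNull_iff (hM : M.AccRel₀) {m : Body} (hm : m ∈ M.IOb) (p q : Fin d → Q) :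
    IsNull (p - q) ↔ (M.Ph ∩ M.ev m p ∩ M.ev m q).Nonempty := by
  rw [hM.axEOF.isNull_sub_iff, hM.axPh m hm]

/-- Maps transforming the coordinates of one inertial observer into those of another one preserve
null separation. -/
theorem AccRel₀.preservesNull (hM : M.AccRel₀) {m k : Body} (hm : m ∈ M.IOb) (hk : k ∈ M.IOb)
    {f : (Fin d → Q) → (Fin d → Q)} (hf : ∀ p, M.ev m (f p) = M.ev k p) : PreservesNull f :=
  fun x y => by rw [hM.isNull_iff hm, hf, hf, ← hM.isNull_iff hk]

/-- If `x` and `y` carry the same event, the map moving `x` to `y` and fixing all other points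
respects events. It therefore preserves null separation and is injective, so `x = y`. -/
theorem AccRel₀.ev_injective (hM : M.AccRel₀) (hd : 3 ≤ d) {m : Body} (hm : m ∈ M.IOb) :
    Function.Injective (M.ev m) := by
  classical
  intro x y hxy
  obtain ⟨i, -, hi, -, -⟩ := exists_two_ne_zero hd
  have hf : PreservesNull (Function.update id x y) := by
    refine hM.preservesNull hm hm fun p => ?_
    by_cases h : p = x
    · subst h; simp [hxy]
    · simp [h]
  by_contra hne
  exact hne (hf.injective hi (by simp [Function.update_of_ne (Ne.symm hne)]))

theorem AccRel₀.exists_ev_eq (hM : M.AccRel₀) {m k : Body} (hm : m ∈ M.IOb) (hk : k ∈ M.IOb)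
    (p : Fin d → Q) : ∃ q, M.ev m q = M.ev k p := by
  have : M.ev k p ∈ M.Ev m := by
    rw [hM.axEv m hm k hk]
    exact ⟨p, rfl, hM.ev_nonempty hk p⟩
  obtain ⟨q, hq, -⟩ := this
  exact ⟨q, hq⟩

/-- Worldview transformations between inertial observers are Poincaré transformations. -/
theorem AccRel₀.exists_poincare (hM : M.AccRel₀) (hd : 3 ≤ d) {m k : Body} (hm : m ∈ M.IOb)
    (hk : k ∈ M.IOb) : ∃ (f : (Fin d → Q) → (Fin d → Q)) (L : (Fin d → Q) →ₗ[Q] (Fin d → Q)),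
      (∀ p, M.ev m (f p) = M.ev k p) ∧ (∀ p q, f p - f q = L (p - q)) ∧
      ∀ v, minkForm Q d (L v) (L v) = minkForm Q d v v := by
  choose f hf using hM.exists_ev_eq hm hk
  have hnull := hM.preservesNull hm hk hf
  have hsurj : Function.Surjective f := fun q => by
    obtain ⟨p, hp⟩ := hM.exists_ev_eq hk hm q
    exact ⟨p, hM.ev_injective hd hm (by rw [hf, hp])⟩
  obtain ⟨g, hg⟩ := hnull.exists_addMonoidHom hsurj hd
  have hg0 : ∀ v, g v = f v - f 0 := fun v => by rw [hg, sub_zero]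
  have hgnull : PreservesNull g := fun x y => by
    rw [← map_sub, ← hg, hnull x y]
  have hgsurj : Function.Surjective g := fun w => by
    obtain ⟨v, hv⟩ := hsurj (w + f 0)
    exact ⟨v, by rw [hg0, hv, add_sub_cancel_right]⟩
  have hev : ∀ p, M.ev k p ∈ M.Ev m ∩ M.Ev k := fun p =>
    ⟨⟨f p, hf p, hM.ev_nonempty hk p⟩, ⟨p, rfl, hM.ev_nonempty hk p⟩⟩
  -- When `v` and `g v` are both spatial, the events that `k` sees at `v` and `0` are simultaneous
  -- for both observers, so `AxSymDist` compares the lengths of `v` and `g v`.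
  obtain ⟨L, hL, hLmink⟩ := hgnull.exists_lorentz hgsurj hM.axEOF hd fun v hv hgv => by
    have hgv' : f v 0 = f 0 0 := sub_eq_zero.1 (by rw [hg0] at hgv; exact hgv)
    obtain ⟨r, ⟨p, q, hp, hq, hr⟩, ⟨p', q', hp', hq', hr'⟩⟩ :=
      hM.axSymDist m hm k hk _ (hev v) _ (hev 0) ⟨f v, f 0, hf v, hf 0, hgv'⟩ ⟨v, 0, rfl, rfl, hv⟩
    obtain rfl := (hp _).1 (hf v)
    obtain rfl := (hq _).1 (hf 0)
    obtain rfl := (hp' _).1 rfl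
    obtain rfl := (hq' _).1 rfl
    rw [hM.axEOF.minkForm_self, hM.axEOF.minkForm_self, hg0, spaceComp_sub, ← hr, hr',
      ← spaceComp_sub, sub_zero, ← hg0]
    rw [timeComp, timeComp, hgv, hv]
  exact ⟨f, L, hf, fun p q => by rw [hL, hg], hLmink⟩

theorem AccRel₀.lifeCurve_point (hM : M.AccRel₀) {k : Body} (hk : k ∈ M.Ob) {q : Fin d → Q}
    (hq : k ∈ M.ev k q) : q = Pi.single 0 (timeComp q) := by
  have h := ((hM.axSelf k hk q).1 hq).2
  funext i
  by_cases hi : i = 0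
  · subst hi; simp [timeComp]
  · rw [Pi.single_eq_of_ne hi]
    exact congrFun h ⟨i, hi⟩

/-- The events an observer takes part in are coordinatized by every inertial observer. -/
theorem AccRel₀.exists_ev_eq_of_self (hM : M.AccRel₀) {k m : Body} (hk : k ∈ M.Ob)
    (hm : m ∈ M.IOb) {q : Fin d → Q} (hq : k ∈ M.ev k q) : ∃ p, M.ev k q = M.ev m p := by
  obtain ⟨m₀, hm₀, ⟨⟨p, hp, -⟩, -⟩⟩ := hM.axCmv k hk q hq
  obtain ⟨p', hp'⟩ := hM.exists_ev_eq hm hm₀ p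
  exact ⟨p', hp.trans hp'.symm⟩

/-- No proper time of `k` is lost in the passage to `m`, so the domain is the set in `AxSelfPlus₀`.
Single-valuedness holds because the time determines the point on the axis of `k`, and `ev_injective`
determines its location for `m`. -/
theorem AccRel₀.isCurve_lifeCurve (hM : M.AccRel₀) (hd : 3 ≤ d) {k m : Body} (hk : k ∈ M.Ob)
    (hm : m ∈ M.IOb) : IsCurve (M.lifeCurve k m) := by
  have hdom : relDom (M.lifeCurve k m) = {t : Q | ∃ r, k ∈ M.ev k r ∧ timeComp r = t} := by
    ext t
    constructor
    · rintro ⟨p, q, hq, -, ht⟩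
      exact ⟨q, hq, ht⟩
    · rintro ⟨q, hq, ht⟩
      obtain ⟨p, hp⟩ := hM.exists_ev_eq_of_self hk hm hq
      exact ⟨p, q, hq, hp, ht⟩
  obtain ⟨⟨p, q, hpq, hp, hq⟩, hconn⟩ := hM.axSelfPlus k hk
  refine ⟨?_, hdom ▸ hconn, ?_⟩
  · rintro t p p' ⟨q, hq, hqp, rfl⟩ ⟨q', hq', hqp', ht⟩
    apply hM.ev_injective hd hm
    have : q' = q := by
      rw [hM.lifeCurve_point hk hq', hM.lifeCurve_point hk hq]
      exact congrArg _ ht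
    rw [← hqp', this, hqp]
  · rw [hdom]
    exact ⟨_, ⟨p, hp, rfl⟩, _, ⟨q, hq, rfl⟩, hpq⟩

theorem AccRel₀.exists_derivVector_lifeCurve (hM : M.AccRel₀) (hd : 3 ≤ d) {k m : Body}
    (hk : k ∈ M.Ob) (hm : m ∈ M.IOb) {t : Q} (ht : t ∈ relDom (M.lifeCurve k m)) :
    ∃ v, IsDerivVector (M.lifeCurve k m) t v ∧ minkForm Q d v v = 1 := by
  have hQ := hM.axEOF
  obtain ⟨p₀, q, hq, hqp, rfl⟩ := ht
  obtain ⟨m₀, hm₀, hdom, hcmv⟩ := hM.axCmv k hk q hq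
  obtain ⟨f, L, hf, hfL, hL⟩ := hM.exists_poincare hd hm hm₀
  obtain ⟨K, hK, hLK⟩ := hQ.exists_euclLength_map_le L
  have hlen0 : euclLength (q - q) = 0 := by
    have := hQ.euclLength_le_sum (q - q)
    simp only [sub_self, Pi.zero_apply, abs_zero, Finset.sum_const_zero] at this ⊢
    exact this.antisymm (euclLength_nonneg _)
  -- At `p = q` the co-moving estimate has right-hand side `0`, so `q` is mapped to itself; the
  -- choice of `ε` is immaterial.
  have hq₀ : M.ev k q = M.ev m₀ q := by
    obtain ⟨δ, hδ, h⟩ := hcmv 1 one_pos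
    obtain ⟨p', hp', hle⟩ := h q hdom (by rwa [hlen0])
    rw [hlen0, mul_zero] at hle
    have : p' = q := by
      funext i
      exact sub_eq_zero.1 (abs_nonpos_iff.1 ((hQ.abs_le_euclLength (p' - q) i).trans hle))
    subst this
    exact ((hp' p').2 rfl).1
  have hfq : f q = p₀ := hM.ev_injective hd hm (by rw [hf, ← hq₀, hqp])
  refine ⟨L (Pi.single 0 1), ⟨p₀, ⟨q, hq, hqp, rfl⟩, fun ε hε => ?_⟩, ?_⟩
  -- The error of the life-curve is the `L`-image of the co-moving error, so dividing by the bound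
  -- `K` of `L` compensates for it.
  · obtain ⟨δ, hδ, h⟩ := hcmv (ε / K) (div_pos hε hK)
    refine ⟨δ, hδ, ?_⟩
    rintro s p ⟨r, hr, hrp, rfl⟩ hs
    have hrq : r - q = (timeComp r - timeComp q) • Pi.single 0 1 := by
      conv_lhs => rw [hM.lifeCurve_point hk hr, hM.lifeCurve_point hk hq]
      rw [← Pi.single_sub, single_eq_smul]
    have hlen : ∀ x : Q, euclLength (x • Pi.single 0 1 : Fin d → Q) ≤ |x| := fun x => by
      refine (hQ.euclLength_le_sum _).trans_eq ?_
      rw [Finset.sum_eq_single 0] <;> simp +contextual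
    obtain ⟨x, hx⟩ := hM.exists_ev_eq_of_self hk hm₀ hr
    obtain ⟨p', hp', hle⟩ := h r ⟨x, hx, ⟨k, hr⟩⟩ (by
      rw [← neg_sub, hrq, ← neg_smul]
      exact (hlen _).trans_lt (by rwa [abs_neg]))
    have hrp' : M.ev k r = M.ev m₀ p' := ((hp' p').2 rfl).1
    have hfp : f p' = p := hM.ev_injective hd hm (by rw [hf, ← hrp', hrp])
    have : p - p₀ - (timeComp r - timeComp q) • L (Pi.single 0 1) = L (p' - r) := by
      rw [← hfp, ← hfq, hfL, ← map_smul, ← hrq, ← map_sub, sub_sub_sub_cancel_right]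
    rw [this]
    calc euclLength (L (p' - r)) ≤ K * euclLength (p' - r) := hLK _
      _ ≤ K * (ε / K * euclLength (r - q)) := mul_le_mul_of_nonneg_left hle hK.le
      _ = ε * euclLength (r - q) := by rw [← mul_assoc, mul_div_cancel₀ _ hK.ne']
      _ ≤ _ := mul_le_mul_of_nonneg_left (hrq ▸ hlen _) hε.le
  · rw [hL, minkForm_single_zero]
    simp

end KinFrame

theorem mainTheorem10 {Q : Type*} [Field Q] [LinearOrder Q] [IsStrictOrderedRing Q]
    {d : ℕ} [NeZero d] (hd : 3 ≤ d) {Body : Type*} (M : KinFrame Q d Body) (hM : M.AccRel₀)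
    (k : Body) (hk : k ∈ M.Ob) (m : Body) (hm : m ∈ M.IOb) :
    IsWellParametrizedTimelikeCurve (M.lifeCurve k m) := by
  have hγ := hM.isCurve_lifeCurve hd hk hm
  have key : ∀ t ∈ relDom (M.lifeCurve k m), ∀ v, IsDerivVector (M.lifeCurve k m) t v →
      minkForm Q d v v = 1 := by
    intro t ht v hv
    obtain ⟨w, hw, hw1⟩ := hM.exists_derivVector_lifeCurve hd hk hm ht
    rwa [hγ.derivVector_unique hM.axEOF hv hw]
  refine ⟨⟨hγ, fun t ht => ⟨?_, fun v hv => ?_⟩⟩, fun t ht v hv => ?_⟩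
  · obtain ⟨w, hw, -⟩ := hM.exists_derivVector_lifeCurve hd hk hm ht
    exact ⟨w, hw⟩
  · exact hM.axEOF.isTimelike_of_minkForm_eq_one (key t ht v hv)
  · exact hM.axEOF.minkLength_of_minkForm_eq_one (key t ht v hv)
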